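/- Let $m\ge 1$ and let $(t,y)=\sum_{j=1}^m t_jy_j$. A centrally symmetric convex body in $\mathbb R^m$ is a compact convex set $V$ with non-empty interior and $V=-V$. Its polar is $V^*=\{y\in\mathbb R^m:\ |(t,y)|\le 1\text{ for all }t\in V\}$; put $\|x\|_V=\max_{t\in V^*}|(t,x)|$ for $x\in\mathbb R^m$ and $\|z\|_{V^*}=\max_{t\in V}\bigl|\sum_{j=1}^m t_jz_j\bigr|$ for $z\in\mathbb C^m$. An entire function $f:\mathbb C^m\to\mathbb C$ has exponential type $V$ if for every $\varepsilon>0$ there is a constant $C_0(\varepsilon,f)>0$ such that $|f(z)|\le C_0(\varepsilon,f)\,e^{(1+\varepsilon)\|z\|_{V^*}}$ for all $z\in\mathbb C^m$. Let $B_V\cap C(\mathbb R^m)$ be the set of all such $f$ that are bounded on $\mathbb R^m$, put $\|f\|_{C(\mathbb R^m)}=\sup_{x\in\mathbb R^m}|f(x)|$, and let $(\nabla f(x),y)=\sum_{j=1}^m\frac{\partial f(x)}{\partial x_j}y_j$. **Theorem 2.1.** Let $K,V$ be centrally symmetric convex bodies in $\mathbb R^m$, and let $$M(K,V)=\max_{y\in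 V}\|y\|_K,\qquad \mathcal A(K,V)=\{\mathbf a\in\partial V:\ \|\mathbf a\|_K=M(K,V)\}.$$ For every $f\in B_V\cap C(\mathbb R^m)$, $x\in\mathbb R^m$, $y\in\partial(K^*)$ and $\alpha\in\mathbb R$, $$\left|\sin\alpha\,(\nabla f(x),y)-M(K,V)\cos\alpha\, f(x)\right|\le M(K,V)\,\|f\|_{C(\mathbb R^m)}.\qquad(*)$$ The set $\mathcal A(K,V)$ is non-empty. For every $\mathbf a\in\mathcal A(K,V)$ and all $C_1,C_2\in\mathbb C$ the function $$f_0(z)=C_1e^{i(\mathbf a,z)}+C_2e^{-i(\mathbf a,z)}$$ belongs to $B_V\cap C(\mathbb R^m)$, with $\|f_0\|_{C(\mathbb R^m)}=|C_1|+|C_2|$. Moreover, for every $\mathbf a\in\mathcal A(K,V)$ there is $y_0\in\partial(K^*)$ such that for all $\alpha\in\mathbb R$ and all $C_1,C_2\in\mathbb C$ there is $x_0\in\mathbb R^m$ for which equality holds in $(*)$ with $f=f_0$, $x=x_0$, $y=y_0$. Hence $(*)$ is sharp: for every $\alpha\in\mathbb R$, the factor $M(K,V)$ on the right-hand side of $(*)$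 cannot be replaced by a smaller constant valid for all $f\in B_V\cap C(\mathbb R^m)$, $x\in\mathbb R^m$ and $y\in\partial(K^*)$. -/

import Mathlib

noncomputable section

namespace BernsteinBody

/-- A centrally symmetric (with respect to the origin) convex body in `ℝ^m`: a compact convex set
with non-empty interior that is invariant under `x ↦ -x`. -/
structure IsSymmConvexBody {m : ℕ} (V : Set (EuclideanSpace ℝ (Fin m))) : Prop where
  isCompact : IsCompact V
  convex : Convex ℝ V
  interior_nonempty : (interior V).Nonempty
  neg_mem : ∀ x ∈ V, -x ∈ V

/-- The real inner product `(t, y) = ∑ t_j y_j`. -/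
def dot {m : ℕ} (t y : EuclideanSpace ℝ (Fin m)) : ℝ := ∑ j, t j * y j

/-- The polar `V^* = {y : |(t, y)| ≤ 1 for all t ∈ V}`. -/
def polarBody {m : ℕ} (V : Set (EuclideanSpace ℝ (Fin m))) : Set (EuclideanSpace ℝ (Fin m)) :=
  {y | ∀ t ∈ V, |dot t y| ≤ 1}

/-- The norm `‖x‖_V = max_{t ∈ V^*} |(t, x)|` (for a symmetric convex body `V` the set `V^*` is
compact and non-empty, so that the supremum is a maximum). -/
def bodyNorm {m : ℕ} (V : Set (EuclideanSpace ℝ (Fin m))) (x : EuclideanSpace ℝ (Fin m)) : ℝ :=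
  sSup ((fun t => |dot t x|) '' polarBody V)

/-- The norm `‖z‖_{V^*} = max_{t ∈ V} |∑ t_j z_j|` of a complex vector `z`. -/
def complexPolarNorm {m : ℕ} (V : Set (EuclideanSpace ℝ (Fin m)))
    (z : EuclideanSpace ℂ (Fin m)) : ℝ :=
  sSup ((fun t : EuclideanSpace ℝ (Fin m) => ‖∑ j, (t j : ℂ) * z j‖) '' V)

/-- The constant `M(K, V) = max_{y ∈ V} ‖y‖_K`. -/
def bodyConst {m : ℕ} (K V : Set (EuclideanSpace ℝ (Fin m))) : ℝ :=
  sSup (bodyNorm K '' V)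

/-- The set `A(K, V)` of the points of the boundary of `V` at which `‖·‖_K` equals `M(K, V)`. -/
def extremalPoints {m : ℕ} (K V : Set (EuclideanSpace ℝ (Fin m))) :
    Set (EuclideanSpace ℝ (Fin m)) :=
  {a | a ∈ frontier V ∧ bodyNorm K a = bodyConst K V}

/-- `f : ℂ^m → ℂ` is an entire function of exponential type `V`. -/
structure HasExpType {m : ℕ} (V : Set (EuclideanSpace ℝ (Fin m)))
    (f : EuclideanSpace ℂ (Fin m) → ℂ) : Prop where
  entire : Differentiable ℂ f
  growth : ∀ ε : ℝ, 0 < ε → ∃ C : ℝ, 0 < C ∧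
    ∀ z, ‖f z‖ ≤ C * Real.exp ((1 + ε) * complexPolarNorm V z)

/-- The restriction of `f : ℂ^m → ℂ` to `ℝ^m`. -/
def realRestrict {m : ℕ} (f : EuclideanSpace ℂ (Fin m) → ℂ) (x : EuclideanSpace ℝ (Fin m)) : ℂ :=
  f (WithLp.toLp 2 fun j => (x j : ℂ))

/-- The class `B_V ∩ C(ℝ^m)`: entire functions of exponential type `V` that are bounded on `ℝ^m`
(continuity on `ℝ^m` is automatic). -/
def BoundedExpType {m : ℕ} (V : Set (EuclideanSpace ℝ (Fin m))) :
    Set (EuclideanSpace ℂ (Fin m) → ℂ) :=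
  {f | HasExpType V f ∧ BddAbove (Set.range fun x => ‖realRestrict f x‖)}

/-- The uniform norm `‖f‖_{C(ℝ^m)}`. -/
def realSupNorm {m : ℕ} (f : EuclideanSpace ℂ (Fin m) → ℂ) : ℝ :=
  ⨆ x, ‖realRestrict f x‖

/-- The partial derivative `∂f/∂x_j` of the restriction of `f` to `ℝ^m`. -/
def partialDeriv {m : ℕ} (f : EuclideanSpace ℂ (Fin m) → ℂ) (j : Fin m)
    (x : EuclideanSpace ℝ (Fin m)) : ℂ :=
  lineDeriv ℝ (realRestrict f) x (EuclideanSpace.single j 1)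

/-- The pairing `(∇f(x), y) = ∑ ∂f/∂x_j(x) y_j`. -/
def gradDot {m : ℕ} (f : EuclideanSpace ℂ (Fin m) → ℂ) (x y : EuclideanSpace ℝ (Fin m)) : ℂ :=
  ∑ j, partialDeriv f j x * (y j : ℂ)

/-- The modulus `|sin α (∇f(x), y) - M(K, V) cos α f(x)|`. -/
def szegoModulus {m : ℕ} (K V : Set (EuclideanSpace ℝ (Fin m)))
    (f : EuclideanSpace ℂ (Fin m) → ℂ) (x y : EuclideanSpace ℝ (Fin m)) (α : ℝ) : ℝ :=
  ‖(Real.sin α : ℂ) * gradDot f x y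
    - (bodyConst K V : ℂ) * (Real.cos α : ℂ) * realRestrict f x‖

/-- The function `C₁ e^{i(a, z)} + C₂ e^{-i(a, z)}` on `ℂ^m`. -/
def expPair {m : ℕ} (a : EuclideanSpace ℝ (Fin m)) (C₁ C₂ : ℂ) (z : EuclideanSpace ℂ (Fin m)) : ℂ :=
  C₁ * Complex.exp (Complex.I * ∑ j, (a j : ℂ) * z j)
    + C₂ * Complex.exp (-(Complex.I * ∑ j, (a j : ℂ) * z j))

end BernsteinBody

end

/-! The inequality is one-dimensional. For `y` in `K^*` and `M = M(K, V)`, the direction `v = y / M`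
satisfies `|(t, v)| ≤ 1` on `V`, so `f` restricted to a complex line with direction `v` is an entire
function `g` of exponential type `1`, bounded on the real line by `‖f‖`. Parametrizing the line so
that `x` sits at parameter `α`, everything follows from `|sin α g'(α) - cos α g(α)| ≤ B` for `|g| ≤
B` on the reals (`norm_sin_mul_deriv_sub_cos_mul_le`).

The left side is `sin² α` times the modulus of `(g / sin)'(α)`. Phragmén–Lindelöf gives `|g(z)| ≤ B
e^{|Im z|}`, so `g / sin` is bounded on the circles of radius `(N + 1/2)π`, and Cauchy's formula
yields the expansion `(g / sin)'(α) = -∑ (-1)^k g(kπ) / (α - kπ)²`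
(`tendsto_deriv_div_sin_add_sum`). The same expansion for `g = cos` reads `∑ 1 / (α - kπ)² = 1 /
sin² α`. Comparing the two term by term gives the bound with its sharp constant.

For sharpness, `M` is the maximum of `|(t, y)|` over `K^* × V`; scaling pushes maximizers to the
boundaries. When `(a, y₀) = M`, the operator acts on `expPair` as multiplication by `-M` and
translation of the phase `(a, x)` by `-α`, so a point of maximal modulus can be reached. -/

namespace BernsteinBody

/-! ### Growth of functions of type one, lower bounds for the sine, and removable singularities. -/

section OneVariable

open Filter Topology Metric

/-- A Phragmén–Lindelöf bound: a function of exponential type `1` bounded by `B` on the real line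
is bounded by `B * exp (Im z)` on the closed upper half-plane. -/
theorem norm_le_mul_exp_im_of_im_nonneg {g : ℂ → ℂ} {B : ℝ} (hg : Differentiable ℂ g)
    (htype : ∀ ε : ℝ, 0 < ε → ∃ C : ℝ, ∀ z, ‖g z‖ ≤ C * Real.exp ((1 + ε) * ‖z‖))
    (hB : ∀ x : ℝ, ‖g x‖ ≤ B) {z : ℂ} (hz : 0 ≤ z.im) : ‖g z‖ ≤ B * Real.exp z.im := by
  have key : ∀ ε : ℝ, 0 < ε → ‖g z‖ ≤ B * Real.exp ((1 + ε) * z.im) := by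
    intro ε hε
    obtain ⟨C, hC⟩ := htype ε hε
    have hC0 : 0 ≤ C := by
      have := (norm_nonneg _).trans (hC 0)
      simpa using this
    -- The rotation turns the upper half-plane into the right one. The exponential cancels the
    -- growth on the positive axis and has modulus one on the imaginary axis, where `B` bounds `F`.
    set F : ℂ → ℂ := fun w => g (Complex.I * w) * Complex.exp (-((1 + ε : ℝ) * w)) with hF
    have hFd : Differentiable ℂ F := by
      have h1 : Differentiable ℂ fun w : ℂ => g (Complex.I * w) := hg.comp (by fun_prop)
      exact h1.mul (by fun_prop)
    have hFn : ∀ w, ‖F w‖ = ‖g (Complex.I * w)‖ * Real.exp (-((1 + ε) * w.re)) := by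
      intro w
      rw [hF]
      simp only [norm_mul, Complex.norm_exp, Complex.neg_re, Complex.re_ofReal_mul]
    have hw : ‖F (-Complex.I * z)‖ ≤ B := by
      apply PhragmenLindelof.right_half_plane_of_bounded_on_real hFd.diffContOnCl
      -- Order `1` is below the critical order `2` of a half-plane; each of the two factors of `F`
      -- contributes `1 + ε` to the type.
      · refine ⟨1, by norm_num, 2 * (1 + ε), ?_⟩
        refine Asymptotics.IsBigO.of_bound C (Eventually.of_forall fun w => ?_)
        rw [hFn, Real.norm_of_nonneg (Real.exp_pos _).le, Real.rpow_one]
        calc ‖g (Complex.I * w)‖ * Real.exp (-((1 + ε) * w.re))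
            ≤ (C * Real.exp ((1 + ε) * ‖Complex.I * w‖)) * Real.exp ((1 + ε) * ‖w‖) := by
              gcongr
              · exact hC _
              · have := (abs_le.1 (Complex.abs_re_le_norm w)).1
                nlinarith
          _ = C * Real.exp (2 * (1 + ε) * ‖w‖) := by
              rw [norm_mul, Complex.norm_I, one_mul, mul_assoc, ← Real.exp_add]
              ring_nf
      · refine isBoundedUnder_of_eventually_le (a := C) ?_
        filter_upwards [eventually_ge_atTop 0] with x hx
        rw [hFn]
        have := hC (Complex.I * x)
        rw [norm_mul, Complex.norm_I, one_mul, Complex.norm_real, Real.norm_of_nonneg hx] at this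
        calc _ ≤ (C * Real.exp ((1 + ε) * x)) * Real.exp (-((1 + ε) * x)) := by
              rw [Complex.ofReal_re]; gcongr
          _ = C := by rw [mul_assoc, ← Real.exp_add]; simp
      · intro x
        rw [hFn]
        have : Complex.I * (x * Complex.I) = ((-x : ℝ) : ℂ) := by
          push_cast; linear_combination (x : ℂ) * Complex.I_mul_I
        rw [this]
        simpa using hB (-x)
      · simpa using hz
    rw [hFn, ← mul_assoc] at hw
    simp only [mul_neg, neg_mul, Complex.I_mul_I, neg_neg, one_mul, Complex.mul_re, Complex.neg_re,
      Complex.I_re, Complex.I_im, zero_mul, zero_sub, Real.exp_neg] at hw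
    rwa [← div_eq_mul_inv, div_le_iff₀ (Real.exp_pos _)] at hw
  have hlim : Tendsto (fun ε : ℝ => B * Real.exp ((1 + ε) * z.im)) (𝓝[>] 0)
      (𝓝 (B * Real.exp z.im)) := by
    refine Tendsto.mono_left (Continuous.tendsto' (by fun_prop) _ _ (by simp)) nhdsWithin_le_nhds
  refine ge_of_tendsto hlim ?_
  filter_upwards [self_mem_nhdsWithin] with ε hε using key ε hε

theorem norm_le_mul_exp_abs_im {g : ℂ → ℂ} {B : ℝ} (hg : Differentiable ℂ g)
    (htype : ∀ ε : ℝ, 0 < ε → ∃ C : ℝ, ∀ z, ‖g z‖ ≤ C * Real.exp ((1 + ε) * ‖z‖))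
    (hB : ∀ x : ℝ, ‖g x‖ ≤ B) (z : ℂ) : ‖g z‖ ≤ B * Real.exp |z.im| := by
  rcases le_total 0 z.im with h | h
  · rw [abs_of_nonneg h]
    exact norm_le_mul_exp_im_of_im_nonneg hg htype hB h
  · have := norm_le_mul_exp_im_of_im_nonneg (g := fun w => g (-w)) (B := B) (z := -z)
      (hg.comp (by fun_prop)) (fun ε hε => (htype ε hε).imp fun C hC w => by simpa using hC (-w))
      (fun x => by simpa using hB (-x)) (by simpa using h)
    rw [abs_of_nonpos h]
    simpa using this

/-- On the circles of radius `(N + 1/2) π` the sine has maximal exponential growth. -/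
theorem exp_abs_im_le_four_mul_norm_sin (N : ℕ) {z : ℂ} (hz : ‖z‖ = (N + 1 / 2) * Real.pi) :
    Real.exp |z.im| ≤ 4 * ‖Complex.sin z‖ := by
  have hsq : ‖Complex.sin z‖ ^ 2 = Real.sin z.re ^ 2 + Real.sinh z.im ^ 2 := by
    rw [← Complex.normSq_eq_norm_sq, Complex.normSq_apply, Complex.sin_eq z]
    simp only [← Complex.ofReal_sin, ← Complex.ofReal_cos, ← Complex.ofReal_sinh,
      ← Complex.ofReal_cosh]
    simp only [← Complex.ofReal_mul, Complex.add_re, Complex.add_im, Complex.ofReal_re,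
      Complex.ofReal_im, Complex.re_ofReal_mul, Complex.im_ofReal_mul, Complex.I_re, Complex.I_im]
    have h1 := Real.sin_sq_add_cos_sq z.re
    have h2 := Real.cosh_sq z.im
    linear_combination (Real.sin z.re) ^ 2 * h2 + (Real.sinh z.im) ^ 2 * h1
  -- Away from the real axis `sinh |Im z|` alone suffices. Near it, `|Re z|` is close to the radius,
  -- an odd multiple of `π / 2`, where the real sine is close to `±1`.
  rcases le_or_gt 1 |z.im| with h | h
  · have h1 : Real.sinh |z.im| ≤ ‖Complex.sin z‖ := by
      refine le_of_sq_le_sq ?_ (norm_nonneg _)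
      have : Real.sinh |z.im| ^ 2 = Real.sinh z.im ^ 2 := by
        rw [← Real.abs_sinh, sq_abs]
      nlinarith [sq_nonneg (Real.sin z.re)]
    rw [Real.sinh_eq] at h1
    have h2 : 2 ≤ Real.exp |z.im| := by linarith [Real.add_one_le_exp |z.im|]
    have h3 : Real.exp (-|z.im|) ≤ 1 := Real.exp_le_one_iff.2 (by linarith)
    linarith
  · set R := (N + 1 / 2) * Real.pi with hR
    have hRpos : 3 / 2 ≤ R := by
      have := Real.pi_gt_three
      have : (0 : ℝ) ≤ N := N.cast_nonneg
      nlinarith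
    have hn : |z.re| ^ 2 + |z.im| ^ 2 = R ^ 2 := by
      rw [← hz, ← Complex.normSq_eq_norm_sq, Complex.normSq_apply, sq_abs, sq_abs]; ring
    have hle : |z.re| ≤ R := hz ▸ Complex.abs_re_le_norm z
    -- `(R - |Re z|)(R + |Re z|) = (Im z)² < 1` and `R ≥ 3/2`. Then the cosine is at least `1 - 2/9
    -- = 7/9`, and `4 · 7/9 > e`.
    have hd : R - |z.re| ≤ 2 / 3 := by
      have := abs_nonneg z.re
      have := abs_nonneg z.im
      nlinarith
    have hcos : 7 / 9 ≤ Real.cos (R - |z.re|) := by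
      have := Real.one_sub_sq_div_two_le_cos (x := R - |z.re|)
      nlinarith
    have hsin : Real.sin z.re ^ 2 = Real.cos (R - |z.re|) ^ 2 := by
      have h1 : Real.sin z.re ^ 2 = Real.sin |z.re| ^ 2 := by
        rcases abs_cases z.re with h | h <;> simp [h.1]
      have h2 : |z.re| = (Real.pi / 2 - (R - |z.re|)) + N * Real.pi := by rw [hR]; ring
      rw [h1, h2, Real.sin_add_nat_mul_pi, Real.sin_pi_div_two_sub, mul_pow, ← pow_mul,
        mul_comm N 2, pow_mul, neg_one_sq, one_pow, one_mul, ← h2]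
    have h1 : 7 / 9 ≤ ‖Complex.sin z‖ := by
      refine le_of_sq_le_sq ?_ (norm_nonneg _)
      nlinarith [sq_nonneg (Real.sinh z.im)]
    have h2 : Real.exp |z.im| ≤ Real.exp 1 := Real.exp_le_exp.2 h.le
    linarith [Real.exp_one_lt_d9]

/-- A quotient of entire functions is holomorphic at the simple zeros of the denominator that are
zeros of the numerator, once it is given the right value there. -/
theorem differentiableAt_div_filled {h s : ℂ → ℂ} (hh : Differentiable ℂ h)
    (hs : Differentiable ℂ s) {c : ℂ} (hsc : s c = 0 → h c = 0 ∧ deriv s c ≠ 0) :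
    DifferentiableAt ℂ (fun z => if s z = 0 then deriv h z / deriv s z else h z / s z) c := by
  by_cases hc : s c = 0
  · obtain ⟨hhc, hdc⟩ := hsc hc
    -- Dividing both functions by `z - c` cancels the common zero: near `c` the filled quotient is
    -- `dslope h c / dslope s c`, whose denominator does not vanish.
    have dh : DifferentiableAt ℂ (dslope h c) c :=
      ((Complex.differentiableOn_dslope univ_mem).2 hh.differentiableOn).differentiableAt univ_mem
    have ds : DifferentiableAt ℂ (dslope s c) c :=
      ((Complex.differentiableOn_dslope univ_mem).2 hs.differentiableOn).differentiableAt univ_mem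
    have hne : dslope s c c ≠ 0 := by rwa [dslope_same]
    refine (dh.div ds hne).congr_of_eventuallyEq ?_
    filter_upwards [ds.continuousAt.eventually_ne hne] with z hz
    rcases eq_or_ne z c with rfl | hzc
    · simp [hc, dslope_same]
    · have e1 : dslope h c z = h z / (z - c) := by
        rw [dslope_of_ne _ hzc, slope_def_field, hhc, sub_zero]
      have e2 : dslope s c z = s z / (z - c) := by
        rw [dslope_of_ne _ hzc, slope_def_field, hc, sub_zero]
      have hzc' : z - c ≠ 0 := sub_ne_zero.2 hzc
      have hsz : s z ≠ 0 := fun h0 => hz (by rw [e2, h0, zero_div])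
      simp only [hsz, if_false, Pi.div_apply, e1, e2]
      field_simp
  · refine ((hh c).div (hs c) hc).congr_of_eventuallyEq ?_
    filter_upwards [(hs c).continuousAt.eventually_ne hc] with z hz
    simp [hz]

/-- By partial fractions the residues at `a` and `b` are opposite, and the remaining multiple of `(z
- b)⁻²` has a primitive. This makes the interpolation terms disappear from Cauchy's integral. -/
theorem circleIntegral_sub_sq_inv_mul_sub_inv {R : ℝ} {a b : ℂ} (ha : a ∈ ball (0 : ℂ) R)
    (hb : b ∈ ball (0 : ℂ) R) (hab : a ≠ b) :
    (∮ z in C(0, R), ((z - b) ^ 2)⁻¹ * (z - a)⁻¹) = 0 := by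
  have hR : 0 ≤ R := dist_nonneg.trans (mem_ball.1 ha).le
  have hne : ∀ w ∈ ball (0 : ℂ) R, ∀ z ∈ sphere (0 : ℂ) R, z - w ≠ 0 := fun w hw z hz h =>
    (mem_ball.1 hw).ne (by rw [← sub_eq_zero.1 h]; exact hz)
  have hci : ∀ w ∈ ball (0 : ℂ) R, CircleIntegrable (fun z => (z - w)⁻¹) 0 R := fun w hw =>
    ContinuousOn.circleIntegrable hR
      (ContinuousOn.inv₀ (by fun_prop) (hne w hw))
  have hci2 : CircleIntegrable (fun z => (z - b) ^ (-2 : ℤ)) 0 R :=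
    ContinuousOn.circleIntegrable hR
      (ContinuousOn.zpow₀ (by fun_prop) _ fun z hz => Or.inl (hne b hb z hz))
  have hab' : a - b ≠ 0 := sub_ne_zero.2 hab
  have hcongr : Set.EqOn (fun z => ((z - b) ^ 2)⁻¹ * (z - a)⁻¹)
      (fun z => ((a - b) ^ 2)⁻¹ * ((z - a)⁻¹ - (z - b)⁻¹) - (a - b)⁻¹ * (z - b) ^ (-2 : ℤ))
      (sphere 0 R) := by
    intro z hz
    have h1 := hne a ha z hz
    have h2 := hne b hb z hz
    have h3 : (z - b) ^ (-2 : ℤ) = ((z - b) ^ 2)⁻¹ := by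
      rw [zpow_neg]; norm_cast
    simp only [h3]
    field_simp
    ring
  rw [circleIntegral.integral_congr hR hcongr, circleIntegral.integral_sub,
    circleIntegral.integral_const_mul, circleIntegral.integral_const_mul,
    circleIntegral.integral_sub (hci a ha) (hci b hb),
    circleIntegral.integral_sub_inv_of_mem_ball ha, circleIntegral.integral_sub_inv_of_mem_ball hb,
    circleIntegral.integral_sub_zpow_of_ne (by norm_num)]
  · simp
  · exact ((hci a ha).sub (hci b hb)).const_fun_smul (a := ((a - b) ^ 2)⁻¹)
  · exact hci2.const_fun_smul (a := (a - b)⁻¹)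

end OneVariable

end BernsteinBody

namespace BernsteinBody

/-! ### Partial fractions for `(g / sin)'` and the one-variable Bernstein–Szegő inequality. -/

section OneVariable

open Filter Topology Metric

/-- Removing from `g / sin` its principal parts at the poles inside the circle leaves a holomorphic
`Q`. In Cauchy's formula for `Q'(a)` the principal parts integrate to zero, so only `g / sin` has to
be estimated on the circle, where it is at most `4 * C`. -/
theorem norm_deriv_div_sin_add_sum_le {g : ℂ → ℂ} {C : ℝ} (hg : Differentiable ℂ g)
    (hC : ∀ z, ‖g z‖ ≤ C * Real.exp |z.im|) {a : ℝ} (ha : Real.sin a ≠ 0) {N : ℕ}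
    (hN : |a| < (N + 1 / 2) * Real.pi) :
    ‖deriv (fun z => g z / Complex.sin z) a
      + ∑ k ∈ Finset.Icc (-N : ℤ) N, Complex.cos (k * Real.pi) * g (k * Real.pi)
          * (((a : ℂ) - k * Real.pi) ^ 2)⁻¹‖
      ≤ (N + 1 / 2) * Real.pi
          * (4 * C / ((N + 1 / 2) * Real.pi - |a|) ^ 2) := by
  set R : ℝ := (N + 1 / 2) * Real.pi with hR
  have hpi := Real.pi_pos
  have hR0 : 0 < R := by positivity
  have hC0 : 0 ≤ C := by simpa using (norm_nonneg _).trans (hC 0)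
  set S : Finset ℤ := Finset.Icc (-N : ℤ) N with hS
  set p : ℤ → ℂ := fun k => k * Real.pi with hp
  have hpsin : ∀ k, Complex.sin (p k) = 0 := fun k => Complex.sin_int_mul_pi k
  have hpinj : Function.Injective p := fun k l h => by
    have h' : (k : ℂ) * Real.pi = l * Real.pi := h
    have := mul_right_cancel₀ (Complex.ofReal_ne_zero.2 Real.pi_ne_zero) h'
    exact_mod_cast this
  have hpnorm : ∀ k, ‖p k‖ = |(k : ℝ)| * Real.pi := fun k => by
    simp [hp, abs_of_pos hpi]
  have hpball : ∀ k ∈ S, p k ∈ ball (0 : ℂ) R := fun k hk => by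
    rw [mem_ball_zero_iff, hpnorm, hR]
    obtain ⟨h1, h2⟩ := Finset.mem_Icc.1 hk
    have h1' : -(N : ℝ) ≤ k := by exact_mod_cast h1
    have h2' : (k : ℝ) ≤ N := by exact_mod_cast h2
    have : |(k : ℝ)| ≤ N := abs_le.2 ⟨h1', h2'⟩
    gcongr
    linarith
  have hcoscos : ∀ k, Complex.cos (p k) * Complex.cos (p k) = 1 := fun k => by
    have := Complex.sin_sq_add_cos_sq (p k)
    rw [hpsin k] at this
    linear_combination this
  have haball : (a : ℂ) ∈ ball (0 : ℂ) R := by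
    rw [mem_ball_zero_iff, Complex.norm_real]; exact hN
  have hsina : Complex.sin (a : ℂ) ≠ 0 := by exact_mod_cast ha
  have hsinR : ∀ z ∈ sphere (0 : ℂ) R, Complex.sin z ≠ 0 := fun z hz h => by
    have := exp_abs_im_le_four_mul_norm_sin N (mem_sphere_zero_iff_norm.1 hz)
    rw [h, norm_zero, mul_zero] at this
    exact this.not_gt (Real.exp_pos _)
  -- the numerator and its quotient by the sine
  set h : ℂ → ℂ := fun z => g z - ∑ k ∈ S, Complex.cos (p k) * g (p k)
    * dslope Complex.sin (p k) z with hh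
  have hds : ∀ k, Differentiable ℂ (dslope Complex.sin (p k)) := fun k z =>
    ((Complex.differentiableOn_dslope univ_mem).2
      Complex.differentiable_sin.differentiableOn).differentiableAt univ_mem
  have hhd : Differentiable ℂ h :=
    hg.sub (Differentiable.fun_sum fun k _ => (hds k).const_mul _)
  have hhp : ∀ j ∈ S, h (p j) = 0 := fun j hj => by
    rw [hh]
    simp only
    rw [Finset.sum_eq_single j]
    · rw [dslope_same, Complex.deriv_sin]
      linear_combination (-g (p j)) * hcoscos j
    · intro k _ hkj
      rw [dslope_of_ne _ (hpinj.ne hkj.symm), slope_def_field, hpsin, hpsin]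
      simp
    · exact fun h => absurd hj h
  set Q : ℂ → ℂ := fun z => if Complex.sin z = 0 then deriv h z / deriv Complex.sin z
    else h z / Complex.sin z with hQ
  -- This open disc contains the closed disc of radius `R`, and the only zeros of the sine in it are
  -- the nodes in `S`.
  have hQd : DifferentiableOn ℂ Q (ball 0 ((N + 1) * Real.pi)) := by
    intro z hz
    refine (differentiableAt_div_filled hhd Complex.differentiable_sin ?_).differentiableWithinAt
    intro hz0
    obtain ⟨k, rfl⟩ := Complex.sin_eq_zero_iff.1 hz0
    constructor
    · refine hhp k (Finset.mem_Icc.2 ?_)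
      rw [mem_ball_zero_iff, hpnorm k, mul_lt_mul_iff_left₀ hpi, abs_lt] at hz
      have h1 : -((N : ℤ) + 1) < k := by exact_mod_cast hz.1
      have h2 : k < (N : ℤ) + 1 := by exact_mod_cast hz.2
      omega
    · rw [Complex.deriv_sin]
      intro h0
      have := hcoscos k
      rw [hp] at this
      simp only [h0] at this
      simp at this
  have hQval : ∀ z, Complex.sin z ≠ 0 → Q z = g z / Complex.sin z
      - ∑ k ∈ S, Complex.cos (p k) * g (p k) * (z - p k)⁻¹ := fun z hz => by
    simp only [hQ, hz, if_false, hh, sub_div, Finset.sum_div]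
    congr 1
    refine Finset.sum_congr rfl fun k _ => ?_
    have hne : z ≠ p k := fun h => hz (h ▸ hpsin k)
    rw [dslope_of_ne _ hne, slope_def_field, hpsin, sub_zero]
    have := sub_ne_zero.2 hne
    field_simp
  -- the derivative of the quotient at `a`
  have hderiv : deriv Q a = deriv (fun z => g z / Complex.sin z) a
      + ∑ k ∈ S, Complex.cos (p k) * g (p k) * (((a : ℂ) - p k) ^ 2)⁻¹ := by
    have hev : Q =ᶠ[𝓝 (a : ℂ)] fun z => g z / Complex.sin z
        - ∑ k ∈ S, Complex.cos (p k) * g (p k) * (z - p k)⁻¹ := by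
      filter_upwards [Complex.continuous_sin.continuousAt.eventually_ne hsina] with z hz
        using hQval z hz
    rw [hev.deriv_eq]
    have h1 : HasDerivAt (fun z => g z / Complex.sin z)
        (deriv (fun z => g z / Complex.sin z) a) a :=
      ((hg a).fun_div (Complex.differentiable_sin a) hsina).hasDerivAt
    have h2 : HasDerivAt (fun z => ∑ k ∈ S, Complex.cos (p k) * g (p k) * (z - p k)⁻¹)
        (∑ k ∈ S, Complex.cos (p k) * g (p k) * (-1 / ((a : ℂ) - p k) ^ 2)) a := by
      refine HasDerivAt.fun_sum fun k _ => ?_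
      have hne : (a : ℂ) - p k ≠ 0 := sub_ne_zero.2 fun h => hsina (h ▸ hpsin k)
      exact (((hasDerivAt_id (a : ℂ)).sub_const (p k)).fun_inv hne).const_mul _
    rw [(h1.fun_sub h2).deriv, sub_eq_add_neg, ← Finset.sum_neg_distrib]
    congr 1
    refine Finset.sum_congr rfl fun k _ => ?_
    rw [div_eq_mul_inv]; ring
  -- Cauchy's formula
  have hne : ∀ w ∈ ball (0 : ℂ) R, ∀ z ∈ sphere (0 : ℂ) R, z - w ≠ 0 := fun w hw z hz h =>
    (mem_ball.1 hw).ne (by rw [← sub_eq_zero.1 h]; exact hz)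
  have hcont : ContinuousOn (fun z : ℂ => ((z - a) ^ 2)⁻¹) (sphere 0 R) :=
    ContinuousOn.inv₀ (by fun_prop) fun z hz => pow_ne_zero 2 (hne a haball z hz)
  have hcauchy := Complex.two_pi_I_inv_smul_circleIntegral_sub_sq_inv_smul_of_differentiable
    isOpen_ball (closedBall_subset_ball (by rw [hR]; nlinarith)) hQd haball
  have hint : (∮ z in C(0, R), ((z - a) ^ 2)⁻¹ • Q z)
      = ∮ z in C(0, R), ((z - a) ^ 2)⁻¹ * (g z / Complex.sin z) := by
    have hcongr : Set.EqOn (fun z => ((z - (a : ℂ)) ^ 2)⁻¹ • Q z)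
        (fun z => ((z - a) ^ 2)⁻¹ * (g z / Complex.sin z)
          - ∑ k ∈ S, Complex.cos (p k) * g (p k) * (((z - a) ^ 2)⁻¹ * (z - p k)⁻¹))
        (sphere 0 R) := by
      intro z hz
      simp only [smul_eq_mul, hQval z (hsinR z hz), mul_sub, Finset.mul_sum]
      congr 1
      exact Finset.sum_congr rfl fun k _ => by ring
    have hci : ∀ k ∈ S, CircleIntegrable (fun z => Complex.cos (p k) * g (p k)
        * (((z - a) ^ 2)⁻¹ * (z - p k)⁻¹)) 0 R := fun k hk =>
      ContinuousOn.circleIntegrable hR0.le (continuousOn_const.mul (hcont.mul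
        (ContinuousOn.inv₀ (by fun_prop) (hne _ (hpball k hk)))))
    rw [circleIntegral.integral_congr hR0.le hcongr, circleIntegral.integral_sub,
      circleIntegral.integral_fun_sum hci, Finset.sum_eq_zero, sub_zero]
    · intro k hk
      rw [circleIntegral.integral_const_mul, circleIntegral_sub_sq_inv_mul_sub_inv (hpball k hk)
        haball fun h => hsina (h ▸ hpsin k), mul_zero]
    · exact ContinuousOn.circleIntegrable hR0.le (hcont.mul
        (hg.continuous.continuousOn.div Complex.continuous_sin.continuousOn hsinR))
    · exact CircleIntegrable.fun_sum _ hci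
  have hRa : 0 < R - |a| := by linarith
  rw [← hderiv, ← hcauchy, hint]
  refine circleIntegral.norm_two_pi_i_inv_smul_integral_le_of_norm_le_const hR0.le fun z hz => ?_
  have hzn : ‖z‖ = R := mem_sphere_zero_iff_norm.1 hz
  have h1 : R - |a| ≤ ‖z - a‖ := by
    have := norm_sub_norm_le z (a : ℂ)
    rwa [hzn, Complex.norm_real, Real.norm_eq_abs] at this
  have h2 : ‖g z / Complex.sin z‖ ≤ 4 * C := by
    rw [norm_div, div_le_iff₀ (norm_pos_iff.2 (hsinR z hz))]
    have := exp_abs_im_le_four_mul_norm_sin N hzn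
    calc ‖g z‖ ≤ C * Real.exp |z.im| := hC z
      _ ≤ C * (4 * ‖Complex.sin z‖) := by gcongr
      _ = _ := by ring
  rw [norm_mul, norm_inv, norm_pow, inv_mul_eq_div]
  gcongr

theorem tendsto_deriv_div_sin_add_sum {g : ℂ → ℂ} {C : ℝ} (hg : Differentiable ℂ g)
    (hC : ∀ z, ‖g z‖ ≤ C * Real.exp |z.im|) {a : ℝ} (ha : Real.sin a ≠ 0) :
    Tendsto (fun N : ℕ => deriv (fun z => g z / Complex.sin z) a
      + ∑ k ∈ Finset.Icc (-N : ℤ) N, Complex.cos (k * Real.pi) * g (k * Real.pi)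
          * (((a : ℂ) - k * Real.pi) ^ 2)⁻¹) atTop (𝓝 0) := by
  have hR : Tendsto (fun N : ℕ => ((N : ℝ) + 1 / 2) * Real.pi) atTop atTop :=
    (tendsto_atTop_add_const_right _ _ tendsto_natCast_atTop_atTop).atTop_mul_const Real.pi_pos
  have hC0 : 0 ≤ C := by simpa using (norm_nonneg _).trans (hC 0)
  have hlim : Tendsto (fun N : ℕ => 16 * C / (((N : ℝ) + 1 / 2) * Real.pi)) atTop (𝓝 0) :=
    tendsto_const_nhds.div_atTop hR
  refine squeeze_zero_norm' ?_ hlim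
  -- The `2 * |a|` gives `R - |a| ≥ R / 2`; the `+ 1` makes `|a| < R` strict even for `a = 0`.
  filter_upwards [hR.eventually_ge_atTop (2 * |a| + 1)] with N hN
  have hpos : 0 < ((N : ℝ) + 1 / 2) * Real.pi := by positivity
  have ha0 := abs_nonneg a
  refine (norm_deriv_div_sin_add_sum_le hg hC ha (by linarith)).trans ?_
  generalize ((N : ℝ) + 1 / 2) * Real.pi = R at *
  have h1 : R / 2 ≤ R - |a| := by linarith
  calc R * (4 * C / (R - |a|) ^ 2) ≤ R * (4 * C / (R / 2) ^ 2) := by gcongr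
    _ = 16 * C / R := by field_simp; ring

/-- The **Bernstein–Szegő inequality** for functions of exponential type `1`. -/
theorem norm_sin_mul_deriv_sub_cos_mul_le {g : ℂ → ℂ} {B : ℝ} (hg : Differentiable ℂ g)
    (htype : ∀ ε : ℝ, 0 < ε → ∃ C : ℝ, ∀ z, ‖g z‖ ≤ C * Real.exp ((1 + ε) * ‖z‖))
    (hB : ∀ x : ℝ, ‖g x‖ ≤ B) (a : ℝ) :
    ‖(Real.sin a : ℂ) * deriv g a - (Real.cos a : ℂ) * g a‖ ≤ B := by
  have hB0 : 0 ≤ B := (norm_nonneg _).trans (hB 0)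
  by_cases ha : Real.sin a = 0
  · rw [ha, Complex.ofReal_zero, zero_mul, zero_sub, norm_neg, norm_mul, Complex.norm_real,
      Real.norm_eq_abs]
    calc _ ≤ 1 * B := by
          gcongr
          · exact Real.abs_cos_le_one a
          · exact hB a
      _ = B := one_mul B
  have hsina : Complex.sin (a : ℂ) ≠ 0 := by exact_mod_cast ha
  have hdiv : ∀ {f : ℂ → ℂ}, Differentiable ℂ f → deriv (fun z => f z / Complex.sin z) a
      = (Complex.sin a * deriv f a - Complex.cos a * f a) / Complex.sin a ^ 2 := by
    intro f hf
    rw [((hf a).hasDerivAt.fun_div (Complex.hasDerivAt_sin a) hsina).deriv]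
    ring
  set t : ℕ → ℝ := fun N => ∑ k ∈ Finset.Icc (-N : ℤ) N, ((a - k * Real.pi) ^ 2)⁻¹ with ht
  -- The expansion applied to `cos`: the coefficients become `cos² (kπ) = 1` and `(cos / sin)' = -1
  -- / sin²`.
  have htlim : Tendsto t atTop (𝓝 ((Real.sin a ^ 2)⁻¹)) := by
    have hcos : ∀ z, ‖Complex.cos z‖ ≤ 1 * Real.exp |z.im| := fun z => by
      rw [Complex.cos, norm_div, one_mul, Complex.norm_two, div_le_iff₀ two_pos]
      refine (norm_add_le _ _).trans ?_
      rw [Complex.norm_exp, Complex.norm_exp]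
      have h1 : Real.exp (z * Complex.I).re ≤ Real.exp |z.im| := by
        simpa using neg_le_abs z.im
      have h2 : Real.exp (-z * Complex.I).re ≤ Real.exp |z.im| := by
        simpa using le_abs_self z.im
      linarith
    have h := tendsto_deriv_div_sin_add_sum Complex.differentiable_cos hcos ha
    rw [hdiv Complex.differentiable_cos, Complex.deriv_cos] at h
    have h0 : (Complex.sin a * -Complex.sin a - Complex.cos a * Complex.cos a)
        / Complex.sin a ^ 2 = -(((Real.sin a ^ 2)⁻¹ : ℝ) : ℂ) := by
      push_cast
      rw [← one_div, ← neg_div]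
      congr 1
      linear_combination -Complex.sin_sq_add_cos_sq (a : ℂ)
    have h1 := (h.const_add (((Real.sin a ^ 2)⁻¹ : ℝ) : ℂ))
    rw [add_zero] at h1
    have h2 := (Complex.continuous_re.tendsto _).comp h1
    rw [Complex.ofReal_re] at h2
    refine h2.congr fun N => ?_
    have h3 : ∑ k ∈ Finset.Icc (-N : ℤ) N, Complex.cos (k * Real.pi) * Complex.cos (k * Real.pi)
          * (((a : ℂ) - k * Real.pi) ^ 2)⁻¹ = (t N : ℂ) := by
      rw [ht]
      push_cast
      refine Finset.sum_congr rfl fun k _ => ?_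
      have h4 := Complex.sin_sq_add_cos_sq (k * Real.pi)
      rw [Complex.sin_int_mul_pi] at h4
      linear_combination (((a : ℂ) - k * Real.pi) ^ 2)⁻¹ * h4
    simp only [Function.comp_apply]
    rw [h3, h0, add_neg_cancel_left, Complex.ofReal_re]
  have hglim := (tendsto_deriv_div_sin_add_sum hg (norm_le_mul_exp_abs_im hg htype hB) ha).norm
  rw [norm_zero] at hglim
  have hle : ‖deriv (fun z => g z / Complex.sin z) a‖ ≤ B * (Real.sin a ^ 2)⁻¹ := by
    have hsum := hglim.add (htlim.const_mul B)
    rw [zero_add] at hsum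
    refine ge_of_tendsto' hsum fun N => ?_
    have h1 : ‖∑ k ∈ Finset.Icc (-N : ℤ) N, Complex.cos (k * Real.pi) * g (k * Real.pi)
          * (((a : ℂ) - k * Real.pi) ^ 2)⁻¹‖ ≤ B * t N := by
      rw [ht, Finset.mul_sum]
      refine norm_sum_le_of_le _ fun k _ => ?_
      have e1 : (k : ℂ) * Real.pi = ((k * Real.pi : ℝ) : ℂ) := by push_cast; rfl
      rw [e1, ← Complex.ofReal_cos, ← Complex.ofReal_sub, ← Complex.ofReal_pow,
        ← Complex.ofReal_inv, norm_mul, norm_mul, Complex.norm_real, Complex.norm_real,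
        Real.norm_eq_abs, Real.norm_of_nonneg (by positivity)]
      calc _ ≤ (1 * B) * ((a - k * Real.pi) ^ 2)⁻¹ := by
            gcongr
            · exact Real.abs_cos_le_one _
            · exact hB _
        _ = _ := by rw [one_mul]
    refine (norm_le_add_norm_add _ _).trans (by gcongr)
  rw [hdiv hg, norm_div, norm_pow, ← Complex.ofReal_sin, ← Complex.ofReal_cos, Complex.norm_real,
    Real.norm_eq_abs, sq_abs, ← div_eq_mul_inv,
    div_le_div_iff_of_pos_right (by positivity)] at hle
  exact hle

end OneVariable

end BernsteinBody

namespace BernsteinBody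

/-! ### Convex bodies, polars and the constant `M(K, V)`. -/

section Bodies

variable {m : ℕ} {K V : Set (EuclideanSpace ℝ (Fin m))}

theorem dot_eq_inner (t y : EuclideanSpace ℝ (Fin m)) : dot t y = inner ℝ t y := by
  simp [dot, PiLp.inner_apply, mul_comm]

theorem abs_dot_le (t y : EuclideanSpace ℝ (Fin m)) : |dot t y| ≤ ‖t‖ * ‖y‖ := by
  rw [dot_eq_inner]; exact abs_real_inner_le_norm t y

theorem dot_smul_left (c : ℝ) (t y : EuclideanSpace ℝ (Fin m)) : dot (c • t) y = c * dot t y := by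
  rw [dot_eq_inner, dot_eq_inner, real_inner_smul_left]

theorem dot_smul_right (c : ℝ) (t y : EuclideanSpace ℝ (Fin m)) : dot t (c • y) = c * dot t y := by
  rw [dot_eq_inner, dot_eq_inner, real_inner_smul_right]

theorem dot_comm (t y : EuclideanSpace ℝ (Fin m)) : dot t y = dot y t := by
  rw [dot_eq_inner, dot_eq_inner, real_inner_comm]

theorem dot_self_pos {t : EuclideanSpace ℝ (Fin m)} (ht : t ≠ 0) : 0 < dot t t := by
  rw [dot_eq_inner]; exact real_inner_self_pos.2 ht

theorem continuous_dot :
    Continuous fun p : EuclideanSpace ℝ (Fin m) × EuclideanSpace ℝ (Fin m) => dot p.1 p.2 := by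
  simp only [dot_eq_inner]; fun_prop

/-- The origin is the midpoint of an interior point and its reflection. -/
theorem IsSymmConvexBody.zero_mem_interior (hV : IsSymmConvexBody V) : 0 ∈ interior V := by
  obtain ⟨x, hx⟩ := hV.interior_nonempty
  have := hV.convex.combo_interior_self_mem_interior hx (hV.neg_mem x (interior_subset hx))
    (a := 1 / 2) (b := 1 / 2) (by norm_num) (by norm_num) (by norm_num)
  simpa using this

theorem IsSymmConvexBody.exists_closedBall_subset (hV : IsSymmConvexBody V) :
    ∃ r > 0, Metric.closedBall 0 r ⊆ V :=
  Metric.nhds_basis_closedBall.mem_iff.1 (mem_interior_iff_mem_nhds.1 hV.zero_mem_interior)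

/-- A point of a closed set all of whose proper dilates lie outside the set is on the frontier. -/
theorem mem_frontier_of_smul_notMem {E : Type*} [NormedAddCommGroup E] [NormedSpace ℝ E]
    {s : Set E} {x : E} (hx : x ∈ s) (h : ∀ c : ℝ, 1 < c → c • x ∉ s) : x ∈ frontier s := by
  refine ⟨subset_closure hx, fun hi => ?_⟩
  have hlim : Filter.Tendsto (fun c : ℝ => c • x) (nhdsWithin 1 (Set.Ioi 1)) (nhds x) :=
    Filter.Tendsto.mono_left (Continuous.tendsto' (by fun_prop) (1 : ℝ) x (one_smul ℝ x))
      nhdsWithin_le_nhds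
  obtain ⟨c, hc, hc1⟩ :=
    ((hlim.eventually (mem_interior_iff_mem_nhds.1 hi)).and self_mem_nhdsWithin).exists
  exact h c hc1 hc

theorem zero_mem_polarBody : 0 ∈ polarBody K := fun t _ => by simp [dot]

theorem isClosed_polarBody : IsClosed (polarBody K) := by
  have : polarBody K = ⋂ t ∈ K, {y | |dot t y| ≤ 1} := by ext y; simp [polarBody]
  rw [this]
  exact isClosed_biInter fun t _ => isClosed_le
    (continuous_dot.comp (by fun_prop : Continuous fun y => (t, y))).abs continuous_const

theorem IsSymmConvexBody.isCompact_polarBody (hK : IsSymmConvexBody K) :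
    IsCompact (polarBody K) := by
  obtain ⟨r, hr, hrK⟩ := hK.exists_closedBall_subset
  refine Metric.isCompact_of_isClosed_isBounded isClosed_polarBody
    ((Metric.isBounded_closedBall (x := 0) (r := 1 / r)).subset fun y hy => ?_)
  rw [mem_closedBall_zero_iff]
  rcases eq_or_ne y 0 with rfl | hy0
  · rw [norm_zero]; positivity
  have hyn : 0 < ‖y‖ := norm_pos_iff.2 hy0
  -- Testing `y` against the point of the ball of radius `r` in its own direction gives `r * ‖y‖ ≤
  -- 1`.
  have h1 := hy ((r / ‖y‖) • y) (hrK (by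
    rw [mem_closedBall_zero_iff, norm_smul, Real.norm_of_nonneg (by positivity),
      div_mul_cancel₀ _ hyn.ne']))
  rw [dot_smul_left, dot_eq_inner, real_inner_self_eq_norm_sq, abs_of_nonneg (by positivity)] at h1
  rw [le_div_iff₀ hr]
  calc ‖y‖ * r = r / ‖y‖ * ‖y‖ ^ 2 := by field_simp
    _ ≤ 1 := h1

theorem IsSymmConvexBody.bddAbove_abs_dot (hK : IsSymmConvexBody K)
    (x : EuclideanSpace ℝ (Fin m)) : BddAbove ((fun t => |dot t x|) '' polarBody K) :=
  (hK.isCompact_polarBody.image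
    (continuous_dot.comp (by fun_prop : Continuous fun t => (t, x))).abs).bddAbove

theorem IsSymmConvexBody.abs_dot_le_bodyNorm (hK : IsSymmConvexBody K)
    {t : EuclideanSpace ℝ (Fin m)} (ht : t ∈ polarBody K) (x : EuclideanSpace ℝ (Fin m)) :
    |dot t x| ≤ bodyNorm K x :=
  le_csSup (hK.bddAbove_abs_dot x) (Set.mem_image_of_mem _ ht)

theorem bodyNorm_le {x : EuclideanSpace ℝ (Fin m)} {c : ℝ}
    (h : ∀ t ∈ polarBody K, |dot t x| ≤ c) : bodyNorm K x ≤ c :=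
  csSup_le ((Set.nonempty_of_mem zero_mem_polarBody).image _) (by rintro _ ⟨t, ht, rfl⟩; exact h t ht)

theorem IsSymmConvexBody.exists_bodyNorm_eq (hK : IsSymmConvexBody K)
    (x : EuclideanSpace ℝ (Fin m)) : ∃ t ∈ polarBody K, |dot t x| = bodyNorm K x :=
  (hK.isCompact_polarBody.image
    (continuous_dot.comp (by fun_prop : Continuous fun t => (t, x))).abs).sSup_mem
    ((Set.nonempty_of_mem zero_mem_polarBody).image _)

/-- The maximum of `|(t, y)|` over `K^* × V` is attained. -/
theorem exists_forall_abs_dot_le (hK : IsSymmConvexBody K) (hV : IsSymmConvexBody V) :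
    ∃ t₀ ∈ polarBody K, ∃ y₀ ∈ V, ∀ t ∈ polarBody K, ∀ y ∈ V, |dot t y| ≤ |dot t₀ y₀| := by
  obtain ⟨⟨t₀, y₀⟩, ⟨ht₀, hy₀⟩, hmax⟩ := (hK.isCompact_polarBody.prod hV.isCompact).exists_isMaxOn
    ⟨(0, 0), zero_mem_polarBody, interior_subset hV.zero_mem_interior⟩
    continuous_dot.abs.continuousOn
  exact ⟨t₀, ht₀, y₀, hy₀, fun t ht y hy => hmax (Set.mk_mem_prod ht hy)⟩

theorem bodyNorm_le_bodyConst (hK : IsSymmConvexBody K) (hV : IsSymmConvexBody V)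
    {y : EuclideanSpace ℝ (Fin m)} (hy : y ∈ V) : bodyNorm K y ≤ bodyConst K V := by
  obtain ⟨t₀, -, y₀, -, hmax⟩ := exists_forall_abs_dot_le hK hV
  refine le_csSup ⟨|dot t₀ y₀|, ?_⟩ (Set.mem_image_of_mem _ hy)
  rintro _ ⟨y, hy, rfl⟩
  exact bodyNorm_le fun t ht => hmax t ht y hy

theorem abs_dot_le_bodyConst (hK : IsSymmConvexBody K) (hV : IsSymmConvexBody V)
    {t y : EuclideanSpace ℝ (Fin m)} (ht : t ∈ polarBody K) (hy : y ∈ V) :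
    |dot t y| ≤ bodyConst K V :=
  (hK.abs_dot_le_bodyNorm ht y).trans (bodyNorm_le_bodyConst hK hV hy)

/-- `V` contains a small ball and, `K` being bounded, so does `K^*`; a common direction pairs
positively with itself. Positivity permits division by `M` and makes dilation strictly increase the
pairing. -/
theorem bodyConst_pos (hm : 1 ≤ m) (hK : IsSymmConvexBody K) (hV : IsSymmConvexBody V) :
    0 < bodyConst K V := by
  obtain ⟨r, hr, hrV⟩ := hV.exists_closedBall_subset
  obtain ⟨R, hR, hKR⟩ := hK.isCompact.isBounded.exists_pos_norm_le
  obtain ⟨v, hv⟩ : ∃ v : EuclideanSpace ℝ (Fin m), ‖v‖ = 1 :=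
    ⟨EuclideanSpace.single ⟨0, hm⟩ 1, by simp⟩
  have hvV : r • v ∈ V := hrV (by
    rw [mem_closedBall_zero_iff, norm_smul, Real.norm_of_nonneg hr.le, hv, mul_one])
  have hvK : R⁻¹ • v ∈ polarBody K := fun t ht => by
    refine (abs_dot_le _ _).trans ?_
    rw [norm_smul, norm_inv, Real.norm_of_nonneg hR.le, hv, mul_one, ← div_eq_mul_inv,
      div_le_one hR]
    exact hKR t ht
  have hv0 : v ≠ 0 := norm_ne_zero_iff.1 (by rw [hv]; exact one_ne_zero)
  refine lt_of_lt_of_le ?_ (abs_dot_le_bodyConst hK hV hvK hvV)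
  rw [dot_smul_left, dot_smul_right]
  have := dot_self_pos hv0
  positivity

theorem extremalPoints_nonempty (hm : 1 ≤ m) (hK : IsSymmConvexBody K)
    (hV : IsSymmConvexBody V) : (extremalPoints K V).Nonempty := by
  obtain ⟨t₀, ht₀, y₀, hy₀, hmax⟩ := exists_forall_abs_dot_le hK hV
  have hle : bodyConst K V ≤ |dot t₀ y₀| :=
    csSup_le ((Set.nonempty_of_mem hy₀).image _) (by
      rintro _ ⟨y, hy, rfl⟩; exact bodyNorm_le fun t ht => hmax t ht y hy)
  have hpos := bodyConst_pos hm hK hV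
  refine ⟨y₀, mem_frontier_of_smul_notMem hy₀ fun c hc hcV => ?_,
    (bodyNorm_le_bodyConst hK hV hy₀).antisymm (hle.trans (hK.abs_dot_le_bodyNorm ht₀ y₀))⟩
  -- A dilate of the maximizer inside `V` would give `c * M ≤ M` with `c > 1`.
  have := abs_dot_le_bodyConst hK hV ht₀ hcV
  rw [dot_smul_right, abs_mul, abs_of_pos (by linarith)] at this
  nlinarith

/-- At an extremal point the norm is attained at a boundary point of the polar body. -/
theorem exists_mem_frontier_dot_eq (hm : 1 ≤ m) (hK : IsSymmConvexBody K)
    (hV : IsSymmConvexBody V) {a : EuclideanSpace ℝ (Fin m)} (ha : a ∈ extremalPoints K V) :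
    ∃ y ∈ frontier (polarBody K), dot a y = bodyConst K V := by
  have hpos := bodyConst_pos hm hK hV
  obtain ⟨t, ht, hta⟩ := hK.exists_bodyNorm_eq a
  rw [ha.2] at hta
  obtain ⟨y, hy, hya⟩ : ∃ y ∈ polarBody K, dot y a = bodyConst K V := by
    rcases le_total 0 (dot t a) with h | h
    · exact ⟨t, ht, by rwa [abs_of_nonneg h] at hta⟩
    · refine ⟨(-1 : ℝ) • t, fun s hs => ?_, ?_⟩
      · rw [dot_smul_right, abs_mul]; simpa using ht s hs
      · rw [dot_smul_left]; rw [abs_of_nonpos h] at hta; linarith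
  refine ⟨y, mem_frontier_of_smul_notMem hy fun c hc hcK => ?_, by rw [dot_comm, hya]⟩
  have := hK.abs_dot_le_bodyNorm hcK a
  rw [dot_smul_left, hya, ha.2, abs_of_pos (by positivity)] at this
  nlinarith

end Bodies

/-! ### Restriction to complex lines and the inequality in several variables. -/

section ExponentialType

variable {m : ℕ} {K V : Set (EuclideanSpace ℝ (Fin m))}

theorem IsSymmConvexBody.norm_sum_le_complexPolarNorm (hV : IsSymmConvexBody V)
    {t : EuclideanSpace ℝ (Fin m)} (ht : t ∈ V) (z : EuclideanSpace ℂ (Fin m)) :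
    ‖∑ j, (t j : ℂ) * z j‖ ≤ complexPolarNorm V z :=
  le_csSup (hV.isCompact.image (by fun_prop)).bddAbove (Set.mem_image_of_mem _ ht)

theorem complexPolarNorm_le (hV : IsSymmConvexBody V) {z : EuclideanSpace ℂ (Fin m)} {c : ℝ}
    (h : ∀ t ∈ V, ‖∑ j, (t j : ℂ) * z j‖ ≤ c) : complexPolarNorm V z ≤ c :=
  csSup_le (hV.interior_nonempty.mono interior_subset |>.image _)
    (by rintro _ ⟨t, ht, rfl⟩; exact h t ht)

theorem complexPolarNorm_nonneg (z : EuclideanSpace ℂ (Fin m)) : 0 ≤ complexPolarNorm V z :=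
  Real.sSup_nonneg (by rintro _ ⟨t, -, rfl⟩; exact norm_nonneg _)

/-- The inclusion of `ℝ^m` into `ℂ^m`. -/
def toComplex (x : EuclideanSpace ℝ (Fin m)) : EuclideanSpace ℂ (Fin m) :=
  WithLp.toLp 2 fun j => (x j : ℂ)

@[simp]
theorem toComplex_apply (x : EuclideanSpace ℝ (Fin m)) (j : Fin m) : toComplex x j = x j := rfl

theorem realRestrict_eq (f : EuclideanSpace ℂ (Fin m) → ℂ) (x : EuclideanSpace ℝ (Fin m)) :
    realRestrict f x = f (toComplex x) := rfl

theorem toComplex_add_smul (x y : EuclideanSpace ℝ (Fin m)) (c : ℝ) :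
    toComplex (x + c • y) = toComplex x + (c : ℂ) • toComplex y := by
  ext j; simp

theorem hasDerivAt_comp_line {f : EuclideanSpace ℂ (Fin m) → ℂ} (hf : Differentiable ℂ f)
    (x v : EuclideanSpace ℂ (Fin m)) (w : ℂ) :
    HasDerivAt (fun w : ℂ => f (x + w • v)) (fderiv ℂ f (x + w • v) v) w := by
  have h : HasDerivAt (fun w : ℂ => x + w • v) v w := by
    simpa using ((hasDerivAt_id w).smul_const v).const_add x
  exact (hf _).hasFDerivAt.comp_hasDerivAt w h

theorem partialDeriv_eq {f : EuclideanSpace ℂ (Fin m) → ℂ} (hf : Differentiable ℂ f) (j : Fin m)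
    (x : EuclideanSpace ℝ (Fin m)) :
    partialDeriv f j x = fderiv ℂ f (toComplex x) (EuclideanSpace.single j 1) := by
  have h := (hasDerivAt_comp_line hf (toComplex x)
    (toComplex (EuclideanSpace.single j 1)) ((0 : ℝ) : ℂ)).comp_ofReal
  have he : toComplex (EuclideanSpace.single j 1) = EuclideanSpace.single j (1 : ℂ) := by
    ext i; rcases eq_or_ne i j with rfl | hij <;> simp [*]
  simp only [he] at h
  rw [partialDeriv, lineDeriv]
  simp only [realRestrict_eq, toComplex_add_smul, he]
  rw [h.deriv]
  simp

/-- Turns the gradient built from real partial derivatives into a complex directional derivative,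
which can be computed along a complex line. -/
theorem gradDot_eq {f : EuclideanSpace ℂ (Fin m) → ℂ} (hf : Differentiable ℂ f)
    (x y : EuclideanSpace ℝ (Fin m)) :
    gradDot f x y = fderiv ℂ f (toComplex x) (toComplex y) := by
  have hy : toComplex y = ∑ j, (y j : ℂ) • EuclideanSpace.single j (1 : ℂ) := by
    ext i
    simp [Finset.sum_apply, Pi.single_apply]
  rw [hy, map_sum, gradDot]
  refine Finset.sum_congr rfl fun j _ => ?_
  rw [partialDeriv_eq hf, map_smul, smul_eq_mul, mul_comm]

theorem norm_realRestrict_le_realSupNorm {f : EuclideanSpace ℂ (Fin m) → ℂ}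
    (hf : f ∈ BoundedExpType V) (x : EuclideanSpace ℝ (Fin m)) :
    ‖realRestrict f x‖ ≤ realSupNorm f :=
  le_ciSup hf.2 x

theorem szegoModulus_le (hm : 1 ≤ m) (hK : IsSymmConvexBody K) (hV : IsSymmConvexBody V)
    {f : EuclideanSpace ℂ (Fin m) → ℂ} (hf : f ∈ BoundedExpType V)
    (x : EuclideanSpace ℝ (Fin m)) {y : EuclideanSpace ℝ (Fin m)} (hy : y ∈ polarBody K) (α : ℝ) :
    szegoModulus K V f x y α ≤ bodyConst K V * realSupNorm f := by
  have hM := bodyConst_pos hm hK hV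
  set M := bodyConst K V with hMdef
  have hMc : (M : ℂ) ≠ 0 := Complex.ofReal_ne_zero.2 hM.ne'
  set v : EuclideanSpace ℂ (Fin m) := ((M⁻¹ : ℝ) : ℂ) • toComplex y with hv
  -- The one-variable inequality uses the same number as angle and as point; this base point puts
  -- `x` at parameter `α`.
  set u : EuclideanSpace ℂ (Fin m) := toComplex x - (α : ℂ) • v with hu
  set g : ℂ → ℂ := fun w => f (u + w • v) with hg
  have hgd : ∀ w, HasDerivAt g (fderiv ℂ f (u + w • v) v) w := hasDerivAt_comp_line hf.1.entire u v
  have huα : u + (α : ℂ) • v = toComplex x := by rw [hu]; abel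
  have hvV : ∀ t ∈ V, ‖∑ j, (t j : ℂ) * v j‖ ≤ 1 := by
    intro t ht
    have h1 : ∑ j, (t j : ℂ) * v j = ((M⁻¹ * dot y t : ℝ) : ℂ) := by
      rw [hv, dot, Finset.mul_sum]
      push_cast
      refine Finset.sum_congr rfl fun j _ => ?_
      rw [PiLp.smul_apply, toComplex_apply, smul_eq_mul]
      push_cast
      ring
    rw [h1, Complex.norm_real, Real.norm_eq_abs, abs_mul, abs_of_pos (inv_pos.2 hM),
      inv_mul_le_iff₀ hM, mul_one]
    exact abs_dot_le_bodyConst hK hV hy ht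
  -- Hence `g` has type `1`: the contribution of `u` is absorbed into the constant.
  have hpolar : ∀ w : ℂ, complexPolarNorm V (u + w • v) ≤ complexPolarNorm V u + ‖w‖ := by
    intro w
    refine complexPolarNorm_le hV fun t ht => ?_
    have h1 : ∑ j, (t j : ℂ) * (u + w • v) j
        = ∑ j, (t j : ℂ) * u j + w * ∑ j, (t j : ℂ) * v j := by
      rw [Finset.mul_sum, ← Finset.sum_add_distrib]
      refine Finset.sum_congr rfl fun j _ => ?_
      rw [PiLp.add_apply, PiLp.smul_apply, smul_eq_mul]
      ring
    rw [h1]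
    refine (norm_add_le _ _).trans (add_le_add (hV.norm_sum_le_complexPolarNorm ht u) ?_)
    rw [norm_mul]
    exact mul_le_of_le_one_right (norm_nonneg _) (hvV t ht)
  have hreal : ∀ s : ℝ, u + (s : ℂ) • v = toComplex (x + ((s - α) * M⁻¹) • y) := by
    intro s
    rw [toComplex_add_smul, ← huα, hv]
    push_cast
    module
  have key := norm_sin_mul_deriv_sub_cos_mul_le (g := g) (B := realSupNorm f)
    (fun w => (hgd w).differentiableAt) (fun ε hε => by
      obtain ⟨C, hC, hle⟩ := hf.1.growth ε hε
      refine ⟨C * Real.exp ((1 + ε) * complexPolarNorm V u), fun w => (hle _).trans ?_⟩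
      rw [mul_assoc, ← Real.exp_add, ← mul_add]
      gcongr
      exact hpolar w)
    (fun s => by
      rw [hg]
      simp only [hreal]
      exact norm_realRestrict_le_realSupNorm hf _) α
  rw [(hgd α).deriv, huα, hv, map_smul, ← gradDot_eq hf.1.entire, hg] at key
  simp only [huα] at key
  have h2 : szegoModulus K V f x y α = M * ‖(Real.sin α : ℂ) * (((M⁻¹ : ℝ) : ℂ) • gradDot f x y)
      - (Real.cos α : ℂ) * f (toComplex x)‖ := by
    have hn : ∀ w : ℂ, M * ‖w‖ = ‖(M : ℂ) * w‖ := fun w => by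
      rw [norm_mul, Complex.norm_real, Real.norm_of_nonneg hM.le]
    rw [hn, szegoModulus, realRestrict_eq, smul_eq_mul, ← hMdef]
    congr 1
    push_cast
    field_simp
  rw [h2]
  gcongr

end ExponentialType

/-! ### The exponential pairs and equality. -/

section ExtremalFunctions

variable {m : ℕ} {K V : Set (EuclideanSpace ℝ (Fin m))}

theorem realRestrict_expPair (a : EuclideanSpace ℝ (Fin m)) (C₁ C₂ : ℂ)
    (x : EuclideanSpace ℝ (Fin m)) : realRestrict (expPair a C₁ C₂) x
      = C₁ * Complex.exp (dot a x * Complex.I) + C₂ * Complex.exp (-(dot a x * Complex.I)) := by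
  rw [realRestrict_eq, expPair]
  have : Complex.I * ∑ j, (a j : ℂ) * toComplex x j = dot a x * Complex.I := by
    rw [dot, mul_comm]; push_cast; rfl
  rw [this]

theorem differentiable_expPair (a : EuclideanSpace ℝ (Fin m)) (C₁ C₂ : ℂ) :
    Differentiable ℂ (expPair a C₁ C₂) := by
  unfold expPair; fun_prop

theorem norm_realRestrict_expPair_le (a : EuclideanSpace ℝ (Fin m)) (C₁ C₂ : ℂ)
    (x : EuclideanSpace ℝ (Fin m)) : ‖realRestrict (expPair a C₁ C₂) x‖ ≤ ‖C₁‖ + ‖C₂‖ := by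
  rw [realRestrict_expPair, ← neg_mul, ← Complex.ofReal_neg]
  refine (norm_add_le _ _).trans_eq ?_
  rw [norm_mul, norm_mul, Complex.norm_exp_ofReal_mul_I, Complex.norm_exp_ofReal_mul_I, mul_one,
    mul_one]

theorem expPair_mem_boundedExpType (hV : IsSymmConvexBody V) {a : EuclideanSpace ℝ (Fin m)}
    (ha : a ∈ V) (C₁ C₂ : ℂ) : expPair a C₁ C₂ ∈ BoundedExpType V := by
  refine ⟨⟨differentiable_expPair a C₁ C₂, fun ε hε => ⟨‖C₁‖ + ‖C₂‖ + 1, by positivity,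
    fun z => ?_⟩⟩, ⟨‖C₁‖ + ‖C₂‖, ?_⟩⟩
  · have hexp : ∀ w : ℂ, ‖w‖ = ‖∑ j, (a j : ℂ) * z j‖ →
        ‖Complex.exp w‖ ≤ Real.exp ((1 + ε) * complexPolarNorm V z) := by
      intro w hw
      refine (Complex.norm_exp_le_exp_norm w).trans (Real.exp_le_exp.2 ?_)
      rw [hw]
      have h1 := hV.norm_sum_le_complexPolarNorm ha z
      have h2 := complexPolarNorm_nonneg (V := V) z
      nlinarith
    refine (norm_add_le _ _).trans ?_
    rw [norm_mul, norm_mul, add_mul, add_mul]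
    have h1 := hexp (Complex.I * ∑ j, (a j : ℂ) * z j) (by simp)
    have h2 := hexp (-(Complex.I * ∑ j, (a j : ℂ) * z j)) (by simp)
    have := mul_le_mul_of_nonneg_left h1 (norm_nonneg C₁)
    have := mul_le_mul_of_nonneg_left h2 (norm_nonneg C₂)
    have := Real.exp_pos ((1 + ε) * complexPolarNorm V z)
    linarith
  · rintro _ ⟨x, rfl⟩
    exact norm_realRestrict_expPair_le a C₁ C₂ x

/-- Two complex numbers can be aligned by rotating them through opposite angles. -/
theorem exists_norm_mul_exp_add_eq (C₁ C₂ : ℂ) : ∃ θ : ℝ,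
    ‖C₁ * Complex.exp (θ * Complex.I) + C₂ * Complex.exp (-(θ * Complex.I))‖ = ‖C₁‖ + ‖C₂‖ := by
  -- Both summands acquire the mean of the two arguments.
  refine ⟨(C₂.arg - C₁.arg) / 2, ?_⟩
  have h : C₁ * Complex.exp (((C₂.arg - C₁.arg) / 2 : ℝ) * Complex.I)
      + C₂ * Complex.exp (-(((C₂.arg - C₁.arg) / 2 : ℝ) * Complex.I))
      = ((‖C₁‖ + ‖C₂‖ : ℝ) : ℂ) * Complex.exp (((C₂.arg + C₁.arg) / 2 : ℝ) * Complex.I) := by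
    have h₁ := Complex.norm_mul_exp_arg_mul_I C₁
    have h₂ := Complex.norm_mul_exp_arg_mul_I C₂
    generalize C₁.arg = θ₁ at *
    generalize C₂.arg = θ₂ at *
    generalize ‖C₁‖ = r₁ at *
    generalize ‖C₂‖ = r₂ at *
    rw [← h₁, ← h₂, mul_assoc, mul_assoc, ← Complex.exp_add, ← Complex.exp_add, Complex.ofReal_add, add_mul]
    congr 3 <;> push_cast <;> ring
  rw [h, norm_mul, Complex.norm_exp_ofReal_mul_I, mul_one, Complex.norm_real,
    Real.norm_of_nonneg (by positivity)]

theorem exists_dot_eq {a : EuclideanSpace ℝ (Fin m)} (ha : a ≠ 0) (θ : ℝ) : ∃ x, dot a x = θ :=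
  ⟨(θ / dot a a) • a, by rw [dot_smul_right, div_mul_cancel₀ _ (dot_self_pos ha).ne']⟩

theorem realSupNorm_expPair {a : EuclideanSpace ℝ (Fin m)} (ha : a ≠ 0) (C₁ C₂ : ℂ) :
    realSupNorm (expPair a C₁ C₂) = ‖C₁‖ + ‖C₂‖ := by
  obtain ⟨θ, hθ⟩ := exists_norm_mul_exp_add_eq C₁ C₂
  obtain ⟨x, hx⟩ := exists_dot_eq ha θ
  refine le_antisymm (ciSup_le (norm_realRestrict_expPair_le a C₁ C₂)) ?_
  rw [← hθ, ← hx, ← realRestrict_expPair]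
  exact le_ciSup (f := fun x => ‖realRestrict (expPair a C₁ C₂) x‖)
    ⟨‖C₁‖ + ‖C₂‖, by rintro _ ⟨x, rfl⟩; exact norm_realRestrict_expPair_le a C₁ C₂ x⟩ x

theorem gradDot_expPair (a : EuclideanSpace ℝ (Fin m)) (C₁ C₂ : ℂ)
    (x y : EuclideanSpace ℝ (Fin m)) : gradDot (expPair a C₁ C₂) x y
      = dot a y * Complex.I * (C₁ * Complex.exp (dot a x * Complex.I)
        - C₂ * Complex.exp (-(dot a x * Complex.I))) := by
  have hd := differentiable_expPair a C₁ C₂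
  have h1 := (hasDerivAt_comp_line hd (toComplex x) (toComplex y) 0)
  rw [zero_smul, add_zero, ← gradDot_eq hd] at h1
  refine h1.unique ?_
  have hlin : ∀ w : ℂ, Complex.I * ∑ j, (a j : ℂ) * (toComplex x + w • toComplex y) j
      = dot a x * Complex.I + w * (dot a y * Complex.I) := by
    intro w
    simp only [dot, Complex.ofReal_sum, Finset.sum_mul, Finset.mul_sum, ← Finset.sum_add_distrib]
    refine Finset.sum_congr rfl fun j _ => ?_
    simp only [PiLp.add_apply, PiLp.smul_apply, smul_eq_mul, toComplex_apply, Complex.ofReal_mul]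
    ring
  simp only [expPair, hlin]
  have hL : HasDerivAt (fun w : ℂ => dot a x * Complex.I + w * (dot a y * Complex.I))
      (dot a y * Complex.I) 0 := by
    simpa using ((hasDerivAt_id (0 : ℂ)).mul_const (dot a y * Complex.I)).const_add
      (dot a x * Complex.I)
  have h2 := (hL.cexp.const_mul C₁).fun_add (hL.fun_neg.cexp.const_mul C₂)
  refine h2.congr_deriv ?_
  rw [zero_mul, add_zero]
  ring

theorem exists_szegoModulus_expPair_eq (hM : 0 ≤ bodyConst K V)
    {a y : EuclideanSpace ℝ (Fin m)} (ha : a ≠ 0) (hay : dot a y = bodyConst K V) (α : ℝ)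
    (C₁ C₂ : ℂ) : ∃ x, szegoModulus K V (expPair a C₁ C₂) x y α
      = bodyConst K V * realSupNorm (expPair a C₁ C₂) := by
  obtain ⟨θ, hθ⟩ := exists_norm_mul_exp_add_eq C₁ C₂
  -- At phase `τ = (a, x)` the expression equals `-M (C₁ e^{i(τ - α)} + C₂ e^{-i(τ - α)})`, so `τ =
  -- θ + α` restores the aligning angle `θ`.
  obtain ⟨x, hx⟩ := exists_dot_eq ha (θ + α)
  refine ⟨x, ?_⟩
  have e1 : Complex.exp (θ * Complex.I) = Complex.exp ((θ + α : ℝ) * Complex.I)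
      * (Complex.cos α - Complex.sin α * Complex.I) := by
    rw [← Complex.cos_neg, sub_eq_add_neg, ← neg_mul, ← Complex.sin_neg, ← Complex.exp_mul_I,
      ← Complex.exp_add]
    congr 1; push_cast; ring
  have e2 : Complex.exp (-(θ * Complex.I)) = Complex.exp (-((θ + α : ℝ) * Complex.I))
      * (Complex.cos α + Complex.sin α * Complex.I) := by
    rw [← Complex.exp_mul_I, ← Complex.exp_add]
    congr 1; push_cast; ring
  rw [realSupNorm_expPair ha, ← hθ, szegoModulus, gradDot_expPair, realRestrict_expPair, hay, hx]
  conv_rhs => rw [← Real.norm_of_nonneg hM, ← Complex.norm_real, ← norm_mul]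
  rw [← norm_neg, e1, e2, Complex.ofReal_sin, Complex.ofReal_cos]
  congr 1
  ring

end ExtremalFunctions

end BernsteinBody

theorem theorem2p1 {m : ℕ} (hm : 1 ≤ m) (K V : Set (EuclideanSpace ℝ (Fin m)))
    (hK : BernsteinBody.IsSymmConvexBody K) (hV : BernsteinBody.IsSymmConvexBody V) :
    -- the inequality
    (∀ f ∈ BernsteinBody.BoundedExpType V, ∀ x : EuclideanSpace ℝ (Fin m),
      ∀ y ∈ frontier (BernsteinBody.polarBody K), ∀ α : ℝ,
        BernsteinBody.szegoModulus K V f x y α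
          ≤ BernsteinBody.bodyConst K V * BernsteinBody.realSupNorm f) ∧
    -- the extremal functions
    (BernsteinBody.extremalPoints K V).Nonempty ∧
    (∀ a ∈ BernsteinBody.extremalPoints K V,
      (∀ C₁ C₂ : ℂ,
        BernsteinBody.expPair a C₁ C₂ ∈ BernsteinBody.BoundedExpType V ∧
        BernsteinBody.realSupNorm (BernsteinBody.expPair a C₁ C₂) = ‖C₁‖ + ‖C₂‖) ∧
      ∃ y₀ ∈ frontier (BernsteinBody.polarBody K), ∀ (α : ℝ) (C₁ C₂ : ℂ),
        ∃ x₀ : EuclideanSpace ℝ (Fin m),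
          BernsteinBody.szegoModulus K V (BernsteinBody.expPair a C₁ C₂) x₀ y₀ α
            = BernsteinBody.bodyConst K V
                * BernsteinBody.realSupNorm (BernsteinBody.expPair a C₁ C₂)) ∧
    -- sharpness of the constant on the right-hand side, for every `α`
    (∀ α : ℝ, IsLeast {c : ℝ | ∀ f ∈ BernsteinBody.BoundedExpType V,
      ∀ x : EuclideanSpace ℝ (Fin m), ∀ y ∈ frontier (BernsteinBody.polarBody K),
        BernsteinBody.szegoModulus K V f x y α ≤ c * BernsteinBody.realSupNorm f}
      (BernsteinBody.bodyConst K V)) := by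
  have hM := BernsteinBody.bodyConst_pos hm hK hV
  have hmain : ∀ f ∈ BernsteinBody.BoundedExpType V, ∀ x : EuclideanSpace ℝ (Fin m),
      ∀ y ∈ frontier (BernsteinBody.polarBody K), ∀ α : ℝ,
        BernsteinBody.szegoModulus K V f x y α
          ≤ BernsteinBody.bodyConst K V * BernsteinBody.realSupNorm f := fun f hf x y hy α =>
    BernsteinBody.szegoModulus_le hm hK hV hf x
      (BernsteinBody.isClosed_polarBody.frontier_subset hy) α
  have hne := BernsteinBody.extremalPoints_nonempty hm hK hV
  have haV : ∀ a ∈ BernsteinBody.extremalPoints K V, a ∈ V := fun a ha =>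
    hV.isCompact.isClosed.frontier_subset ha.1
  have ha0 : ∀ a ∈ BernsteinBody.extremalPoints K V, a ≠ 0 := by
    rintro a ha rfl
    exact ha.1.2 hV.zero_mem_interior
  refine ⟨hmain, hne, fun a ha => ⟨fun C₁ C₂ =>
    ⟨BernsteinBody.expPair_mem_boundedExpType hV (haV a ha) C₁ C₂,
      BernsteinBody.realSupNorm_expPair (ha0 a ha) C₁ C₂⟩, ?_⟩, fun α =>
    ⟨fun f hf x y hy => hmain f hf x y hy α, fun c hc => ?_⟩⟩
  · obtain ⟨y, hy, hay⟩ := BernsteinBody.exists_mem_frontier_dot_eq hm hK hV ha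
    exact ⟨y, hy, BernsteinBody.exists_szegoModulus_expPair_eq hM.le (ha0 a ha) hay⟩
  · obtain ⟨a, ha⟩ := hne
    obtain ⟨y, hy, hay⟩ := BernsteinBody.exists_mem_frontier_dot_eq hm hK hV ha
    -- The single exponential `C₁ = 1`, `C₂ = 0` has norm `1`, so equality forces `M ≤ c`.
    obtain ⟨x, hx⟩ :=
      BernsteinBody.exists_szegoModulus_expPair_eq hM.le (ha0 a ha) hay α 1 0
    have h := hc _ (BernsteinBody.expPair_mem_boundedExpType hV (haV a ha) 1 0) x y hy
    rw [hx, BernsteinBody.realSupNorm_expPair (ha0 a ha)] at h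
    simpa using h
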